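/- **Lemma 3.7.** Notation. For $f,g:\mathbb F_2^n\to\mathbb C$ write $\langle f,g\rangle=\mathbb E_{x\in\mathbb F_2^n}f(x)\overline{g(x)}$, $\|f\|_2=\langle f,f\rangle^{1/2}$, $\Delta_af(x)=f(x+a)\overline{f(x)}$, $\widehat f(b)=\mathbb E_x f(x)(-1)^{b\cdot x}$ and $\|f\|_{U^3}=\big(\mathbb E_{x,a,b,c}\Delta_a\Delta_b\Delta_cf(x)\big)^{1/8}$. A *stabilizer state* is a function $\phi:\mathbb F_2^n\to\mathbb C$ with $\|\phi\|_2=\|\phi\|_{U^3}=1$, and $\mathcal L(\phi)=\{(a,b)\in\mathbb F_2^n\times\mathbb F_2^n: |\widehat{\Delta_a\phi}(b)|=1\}$. A stabilizer state $\phi$ is a *$\gamma$-approximate local maximizer of correlation for $f$* if $|\langle f,\phi\rangle|^2\ge\gamma|\langle f,\phi'\rangle|^2$ for all stabilizer states $\phi'$ with $|\langle\phi,\phi'\rangle|^2=\tfrac12$. For $f\neq 0$ let $P_f(a,b)=\frac{|\widehat{\Delta_af}(b)|^2}{2^n\|f\|_2^4}$ for $(a,b)\in\mathbb F_2^n\times\mathbb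 F_2^n$, let $Q_f=P_f*P_f$, that is $Q_f(p)=\sum_{q\in\mathbb F_2^n\times\mathbb F_2^n}P_f(q)P_f(p-q)$, and write $Q_f(S)=\sum_{p\in S}Q_f(p)$. Let $\mathrm{Spec}(f)=\{(a,b)\in\mathbb F_2^n\times\mathbb F_2^n:|\widehat{\Delta_af}(b)|^2\ge 0.7\|f\|_2^4\}$. A set $F\subseteq\mathbb F_2^n\times\mathbb F_2^n$ is an *$\varepsilon$-approximate spectral set for $f$* if $Q_f(\mathrm{Spec}(f)\setminus F)\le\varepsilon$, and $f$ *$\varepsilon$-robustly generates* a set $L$ if $L\subseteq\mathrm{span}_{\mathbb F_2}(F)$ for every $\varepsilon$-approximate spectral set $F$ for $f$. Statement. Let $\gamma\in(\tfrac12,1)$, $\tau>0$ and $\varepsilon=(\gamma-\tfrac12)^2\tau^8/8$. Let $f:\mathbb F_2^n\to\mathbb C$ satisfy $\|f\|_2\le 1$ (for instance, $|f(x)|\le 1$ for all $x$), and let $\phi$ be a $\gamma$-approximate local maximizer of correlation for $f$ such that $|\langle f,\phi\rangle|\ge\tau$. Suppose that $f$ does not $\varepsilon$-robustly generate $\mathcal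 L(\phi)$. Then $$Q_f\big(\mathcal L(\phi)\setminus\mathrm{Spec}(f)\big)\ge\varepsilon.$$ -/

import Mathlib

open scoped BigOperators

noncomputable section

namespace StabilizerState

/-- The vector space `𝔽₂ⁿ`. -/
abbrev F2 (n : ℕ) : Type := Fin n → ZMod 2

/-- The sign character `(-1)^{b · x}`. -/
def signChar {n : ℕ} (b x : F2 n) : ℂ := (-1 : ℂ) ^ (b ⬝ᵥ x).val

/-- `⟨f, g⟩ = 𝔼ₓ f(x) conj(g(x))`. -/
def corr {n : ℕ} (f g : F2 n → ℂ) : ℂ := 𝔼 x : F2 n, f x * (starRingEnd ℂ) (g x)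

/-- `‖f‖₂ = ⟨f, f⟩^{1/2}`; the number `⟨f, f⟩` is real and nonnegative. -/
def l2norm {n : ℕ} (f : F2 n → ℂ) : ℝ := Real.sqrt (corr f f).re

/-- The multiplicative derivative `Δₐf(x) = f(x + a) conj(f(x))`. -/
def mulDeriv {n : ℕ} (a : F2 n) (f : F2 n → ℂ) : F2 n → ℂ :=
  fun x => f (x + a) * (starRingEnd ℂ) (f x)

/-- The Fourier coefficient `f̂(b) = 𝔼ₓ f(x) (-1)^{b · x}`. -/
def walsh {n : ℕ} (f : F2 n → ℂ) (b : F2 n) : ℂ := 𝔼 x : F2 n, f x * signChar b x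

/-- The Gowers `U³`-norm `(𝔼_{x,a,b,c} ΔₐΔ_bΔ_c f(x))^{1/8}`; the average is real and
nonnegative, being equal to `𝔼_{b,c} |𝔼ₓ Δ_bΔ_c f(x)|²`. -/
def gowersU3 {n : ℕ} (f : F2 n → ℂ) : ℝ :=
  (𝔼 x : F2 n, 𝔼 a : F2 n, 𝔼 b : F2 n, 𝔼 c : F2 n,
    mulDeriv a (mulDeriv b (mulDeriv c f)) x).re ^ (1 / 8 : ℝ)

/-- A stabilizer state is a function with `‖φ‖₂ = ‖φ‖_{U³} = 1`. -/
def IsStabilizer {n : ℕ} (φ : F2 n → ℂ) : Prop := l2norm φ = 1 ∧ gowersU3 φ = 1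

/-- `φ` is a `γ`-approximate local maximizer of correlation for `f`: it is a stabilizer state and
`|⟨f, φ⟩|²` is at least `γ |⟨f, φ'⟩|²` for all stabilizer states `φ'` with `|⟨φ, φ'⟩|² = 1/2`. -/
def IsApproxLocalMaximizer {n : ℕ} (γ : ℝ) (f φ : F2 n → ℂ) : Prop :=
  IsStabilizer φ ∧
    ∀ φ' : F2 n → ℂ, IsStabilizer φ' → ‖corr φ φ'‖ ^ 2 = 1 / 2 →
      γ * ‖corr f φ'‖ ^ 2 ≤ ‖corr f φ‖ ^ 2

/-- `𝓛(φ)`, the set of pairs `(a, b)` such that the Fourier coefficient of `Δₐφ` at `b` has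
absolute value one. -/
def lagrangian {n : ℕ} (φ : F2 n → ℂ) : Set (F2 n × F2 n) :=
  {p | ‖walsh (mulDeriv p.1 φ) p.2‖ = 1}

/-- The spectral set of `f`. -/
def spec {n : ℕ} (f : F2 n → ℂ) : Set (F2 n × F2 n) :=
  {p | 0.7 * l2norm f ^ 4 ≤ ‖walsh (mulDeriv p.1 f) p.2‖ ^ 2}

/-- The characteristic distribution `P_f`. -/
def charDist {n : ℕ} (f : F2 n → ℂ) (p : F2 n × F2 n) : ℝ :=
  1 / (2 ^ n * l2norm f ^ 4) * ‖walsh (mulDeriv p.1 f) p.2‖ ^ 2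

/-- The convoluted distribution `Q_f = P_f * P_f`, as a function on points. -/
def convDist {n : ℕ} (f : F2 n → ℂ) (p : F2 n × F2 n) : ℝ :=
  ∑ q : F2 n × F2 n, charDist f q * charDist f (p - q)

/-- The mass `Q_f(S)` of a set `S`. -/
def convMass {n : ℕ} (f : F2 n → ℂ) (S : Set (F2 n × F2 n)) : ℝ :=
  ∑ p : F2 n × F2 n, S.indicator (convDist f) p

/-- `F` is an `ε`-approximate spectral set for `f`. -/
def IsApproxSpectralSet {n : ℕ} (ε : ℝ) (f : F2 n → ℂ) (F : Set (F2 n × F2 n)) : Prop :=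
  convMass f (spec f \ F) ≤ ε

/-- `f` `η`-robustly generates `L`: every `η`-approximate spectral set for `f` spans (over `𝔽₂`)
a subspace containing `L`. -/
def RobustlyGenerates {n : ℕ} (η : ℝ) (f : F2 n → ℂ) (L : Set (F2 n × F2 n)) : Prop :=
  ∀ F : Set (F2 n × F2 n), IsApproxSpectralSet η f F →
    L ⊆ (Submodule.span (ZMod 2) F : Set (F2 n × F2 n))

end StabilizerState

end

open scoped BigOperators

noncomputable section

namespace StabilizerState

variable {n : ℕ}

/-! Write `L` for the set 𝓛(φ). If `F` is an approximate spectral set whose span misses some `z ∈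
L`, a linear functional kills `F` but not `z`. It is the symplectic character of some point `X`, and
`X ∉ L` because `L` is isotropic. Let `S` be the half of `L` on which this character is `-1`. Since
`S` avoids `F`, its part inside the spectrum has mass at most `ε`, so it suffices that `S` has mass
at least `2ε` (`IsApproxLocalMaximizer.le_convMass`).

P_f is its own symplectic Fourier transform up to scaling, and `L` is its own symplectic complement.
Hence the mass of `S` is a multiple of the difference between the sums of |⟨W_r f, f⟩|⁴ over `L` and
over `L + X` (`convMass_lagrangian_symp`). Expanding `f` in the Weyl translates of φ turns this
difference into a sum over additive quadruples, nonnegative after symmetrization by AM-GM. The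
quadruples in `L ∪ (L + X)` alone give the lower bound `le_sum_weylSq`, in terms of α = ⟨f, φ⟩ and β
= ⟨f, W_X φ⟩.

With A = |α|², B = |β|² and α·conj β = x + iy, that bound is proportional to (A² - B²)² + 16x²y². It
could be small only if A ≈ B and one of |x|, |y| is close to A. But then some (φ + μ W_X φ)/√2 with
μ ∈ {±1, ±i}, which is a stabilizer state at overlap 1/2 with φ, would nearly double the squared
correlation, against local maximality with γ > 1/2 (`local_max_inequality`). -/

/-! ### Signs and their orthogonality -/

/-- The real-valued sign `(-1)^{b · x}`. -/
def sgn (b x : F2 n) : ℝ := (-1 : ℝ) ^ (b ⬝ᵥ x).val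

lemma neg_one_pow_val_add (s t : ZMod 2) :
    (-1 : ℝ) ^ (s + t).val = (-1) ^ s.val * (-1) ^ t.val := by
  rw [ZMod.val_add, ← pow_add, ← neg_one_pow_eq_pow_mod_two]

lemma signChar_eq (b x : F2 n) : signChar b x = (sgn b x : ℂ) := by
  simp [signChar, sgn]

lemma sgn_comm (b x : F2 n) : sgn b x = sgn x b := by
  rw [sgn, sgn, dotProduct_comm]

lemma sgn_add_right (b x y : F2 n) : sgn b (x + y) = sgn b x * sgn b y := by
  rw [sgn, dotProduct_add, neg_one_pow_val_add, sgn, sgn]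

lemma sgn_add_left (b c x : F2 n) : sgn (b + c) x = sgn b x * sgn c x := by
  rw [sgn_comm, sgn_add_right, sgn_comm x, sgn_comm x]

lemma sgn_mul_self (b x : F2 n) : sgn b x * sgn b x = 1 := by
  rw [sgn, ← mul_pow]; simp

lemma sgn_eq_or (b x : F2 n) : sgn b x = 1 ∨ sgn b x = -1 :=
  neg_one_pow_eq_or ℝ _

lemma add_self_F2 (x : F2 n) : x + x = 0 := funext fun i => CharTwo.add_self_eq_zero (x i)

lemma add_self_pair (p : F2 n × F2 n) : p + p = 0 :=
  Prod.ext (add_self_F2 _) (add_self_F2 _)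

lemma neg_pair (p : F2 n × F2 n) : -p = p :=
  neg_eq_of_add_eq_zero_left (add_self_pair p)

lemma sum_sgn (x : F2 n) : ∑ b : F2 n, sgn b x = if x = 0 then (2 : ℝ) ^ n else 0 := by
  split_ifs with h
  · subst h; simp [sgn]
  · obtain ⟨i, hi⟩ : ∃ i, x i ≠ 0 := by
      by_contra! hc; exact h (funext hc)
    have hs : sgn (Pi.single i 1) x = -1 := by
      have : x i = 1 := by
        generalize x i = t at hi
        revert t; decide
      simp [sgn, this, ZMod.val_one]
    -- Translating `b` by a basis vector on which `x` is nonzero flips every sign.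
    have key : ∑ b : F2 n, sgn b x = -∑ b : F2 n, sgn b x := by
      conv_lhs => rw [← Equiv.sum_comp (Equiv.addRight (Pi.single i (1 : ZMod 2)))]
      simp [sgn_add_left, hs]
    linarith

lemma sum_sgn_mul_sgn (x y : F2 n) :
    ∑ b : F2 n, (sgn b x : ℂ) * sgn b y = if y = x then (2 : ℂ) ^ n else 0 := by
  have := congrArg Complex.ofReal (sum_sgn (x + y))
  simp_rw [sgn_add_right] at this
  push_cast at this
  rw [this]
  have e : x + y = 0 ↔ y = x := by
    rw [add_eq_zero_iff_eq_neg, show -y = y from neg_eq_of_add_eq_zero_left (add_self_F2 y)]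
    exact eq_comm
  rw [if_congr e rfl rfl]
  split_ifs <;> simp

/-! ### The inner product -/

lemma expect_eq (f : F2 n → ℂ) : 𝔼 x : F2 n, f x = (∑ x, f x) / 2 ^ n := by
  rw [Fintype.expect_eq_sum_div_card]; simp

lemma corr_eq (f g : F2 n → ℂ) :
    corr f g = (∑ x, f x * (starRingEnd ℂ) (g x)) / 2 ^ n := expect_eq _

lemma corr_add_left (f g h : F2 n → ℂ) : corr (f + g) h = corr f h + corr g h := by
  simp [corr_eq, add_mul, Finset.sum_add_distrib, add_div]

lemma corr_smul_left (c : ℂ) (f h : F2 n → ℂ) : corr (c • f) h = c * corr f h := by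
  simp [corr_eq, mul_assoc, ← Finset.mul_sum, mul_div_assoc]

lemma corr_conj (f g : F2 n → ℂ) : (starRingEnd ℂ) (corr f g) = corr g f := by
  simp only [corr_eq, map_div₀, map_sum, map_mul, map_pow, map_ofNat, Complex.conj_conj, mul_comm]

lemma corr_add_right (f g h : F2 n → ℂ) : corr f (g + h) = corr f g + corr f h := by
  rw [← corr_conj, corr_add_left, map_add, corr_conj, corr_conj]

lemma corr_smul_right (c : ℂ) (f h : F2 n → ℂ) :
    corr f (c • h) = (starRingEnd ℂ) c * corr f h := by
  rw [← corr_conj, corr_smul_left, map_mul, corr_conj]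

lemma norm_corr_comm (f g : F2 n → ℂ) : ‖corr f g‖ = ‖corr g f‖ := by
  rw [← corr_conj, RCLike.norm_conj]

lemma corr_self (f : F2 n → ℂ) : corr f f = ((l2norm f ^ 2 : ℝ) : ℂ) := by
  have h : corr f f = (((∑ x, ‖f x‖ ^ 2) / 2 ^ n : ℝ) : ℂ) := by
    rw [corr_eq]; push_cast
    simp_rw [Complex.mul_conj']
  rw [l2norm, h, Complex.ofReal_re, Real.sq_sqrt (by positivity)]

lemma eq_zero_of_corr_self (f : F2 n → ℂ) (h : corr f f = 0) : f = 0 := by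
  have h' : ((∑ x, ‖f x‖ ^ 2 : ℝ) : ℂ) = 0 := by
    rw [corr_eq, div_eq_zero_iff] at h
    have h := h.resolve_right (pow_ne_zero _ two_ne_zero)
    push_cast
    simpa only [Complex.mul_conj'] using h
  rw [Complex.ofReal_eq_zero, Finset.sum_eq_zero_iff_of_nonneg (fun _ _ => by positivity)] at h'
  funext x
  simpa using h' x (Finset.mem_univ _)

/-! ### Weyl operators and the symplectic form -/

/-- The Weyl operator `W_{(a, b)} f(x) = (-1)^{b · x} f(x + a)`. -/
def weyl (p : F2 n × F2 n) (f : F2 n → ℂ) : F2 n → ℂ := fun x => (sgn p.2 x : ℂ) * f (x + p.1)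

lemma weyl_add (p : F2 n × F2 n) (f g : F2 n → ℂ) : weyl p (f + g) = weyl p f + weyl p g := by
  funext x; simp [weyl, mul_add]

lemma weyl_smul (p : F2 n × F2 n) (c : ℂ) (f : F2 n → ℂ) : weyl p (c • f) = c • weyl p f := by
  funext x; simp [weyl]; ring

lemma weyl_zero (f : F2 n → ℂ) : weyl 0 f = f := by
  funext x; simp [weyl, sgn]

lemma weyl_weyl (p q : F2 n × F2 n) (f : F2 n → ℂ) :
    weyl p (weyl q f) = (sgn q.2 p.1 : ℂ) • weyl (p + q) f := by
  funext x
  simp only [weyl, Prod.fst_add, Prod.snd_add, Pi.smul_apply, smul_eq_mul, sgn_add_left,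
    sgn_add_right, Complex.ofReal_mul, add_assoc]
  ring

lemma weyl_add_index (p q : F2 n × F2 n) (f : F2 n → ℂ) :
    weyl (p + q) f = (sgn q.2 p.1 : ℂ) • weyl p (weyl q f) := by
  rw [weyl_weyl, smul_smul, ← Complex.ofReal_mul, sgn_mul_self, Complex.ofReal_one, one_smul]

lemma weyl_weyl_self (p : F2 n × F2 n) (f : F2 n → ℂ) :
    weyl p (weyl p f) = (sgn p.2 p.1 : ℂ) • f := by
  rw [weyl_weyl, add_self_pair, weyl_zero]

/-- The symplectic sign of two phase-space points. -/
def symp (p q : F2 n × F2 n) : ℝ := sgn p.2 q.1 * sgn q.2 p.1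

lemma symp_comm (p q : F2 n × F2 n) : symp p q = symp q p := mul_comm _ _

lemma symp_add_right (p q r : F2 n × F2 n) : symp p (q + r) = symp p q * symp p r := by
  simp only [symp, Prod.fst_add, Prod.snd_add, sgn_add_left, sgn_add_right]; ring

lemma symp_add_left (p q r : F2 n × F2 n) : symp (p + q) r = symp p r * symp q r := by
  rw [symp_comm, symp_add_right, symp_comm r, symp_comm r]

lemma symp_eq_or (p q : F2 n × F2 n) : symp p q = 1 ∨ symp p q = -1 := by
  rcases sgn_eq_or p.2 q.1 with h | h <;> rcases sgn_eq_or q.2 p.1 with h' | h' <;>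
    simp [symp, h, h']

lemma symp_mul_self (p q : F2 n × F2 n) : symp p q * symp p q = 1 := by
  rcases symp_eq_or p q with h | h <;> simp [h]

lemma weyl_comm (p q : F2 n × F2 n) (f : F2 n → ℂ) :
    weyl p (weyl q f) = (symp p q : ℂ) • weyl q (weyl p f) := by
  rw [weyl_weyl, weyl_weyl, smul_smul, add_comm q p, ← Complex.ofReal_mul, symp]
  congr 2
  linear_combination (-sgn q.2 p.1) * sgn_mul_self p.2 q.1

lemma corr_weyl_weyl (p : F2 n × F2 n) (f g : F2 n → ℂ) :
    corr (weyl p f) (weyl p g) = corr f g := by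
  rw [corr_eq, corr_eq, ← Equiv.sum_comp (Equiv.addRight p.1)
    (fun x => f x * (starRingEnd ℂ) (g x))]
  congr 1
  refine Finset.sum_congr rfl fun x _ => ?_
  have := congrArg (Complex.ofReal) (sgn_mul_self p.2 x)
  push_cast at this
  simp only [weyl, map_mul, Complex.conj_ofReal, Equiv.coe_addRight]
  linear_combination (f (x + p.1) * (starRingEnd ℂ) (g (x + p.1))) * this

lemma corr_weyl_left (p : F2 n × F2 n) (f g : F2 n → ℂ) :
    corr (weyl p f) g = sgn p.2 p.1 * corr f (weyl p g) := by
  rw [← corr_weyl_weyl p f (weyl p g), weyl_weyl_self, corr_smul_right, Complex.conj_ofReal,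
    ← mul_assoc, ← Complex.ofReal_mul, sgn_mul_self]
  simp

lemma corr_weyl_eq_walsh (p : F2 n × F2 n) (f : F2 n → ℂ) :
    corr (weyl p f) f = walsh (mulDeriv p.1 f) p.2 := by
  rw [corr_eq, walsh, expect_eq]
  congr 1
  refine Finset.sum_congr rfl fun x _ => ?_
  rw [signChar_eq, weyl, mulDeriv]; ring

/-! ### Orthogonality of Weyl coefficients and Fourier self-duality -/

/-- Summing over the frequency identifies the two space variables; summing over the shift then
decouples `f, k` from `g, l`. -/
lemma sum_weyl_corr_mul_conj (f g k l : F2 n → ℂ) :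
    ∑ q : F2 n × F2 n, corr (weyl q f) g * (starRingEnd ℂ) (corr (weyl q k) l) =
      2 ^ n * (corr f k * (starRingEnd ℂ) (corr g l)) := by
  have h2 : (2 : ℂ) ^ n ≠ 0 := pow_ne_zero _ two_ne_zero
  have inner (a : F2 n) : ∑ b : F2 n, corr (weyl (a, b) f) g *
      (starRingEnd ℂ) (corr (weyl (a, b) k) l) =
      (∑ x, f (x + a) * (starRingEnd ℂ) (k (x + a)) * ((starRingEnd ℂ) (g x) * l x)) / 2 ^ n := by
    simp only [corr_eq, weyl, map_div₀, map_sum, map_mul, map_pow, map_ofNat, Complex.conj_ofReal,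
      Complex.conj_conj, div_mul_div_comm, ← Finset.sum_div, Finset.sum_mul_sum]
    rw [div_eq_div_iff (mul_ne_zero h2 h2) h2, Finset.sum_comm, Finset.sum_mul, Finset.sum_mul]
    refine Finset.sum_congr rfl fun x _ => ?_
    rw [Finset.sum_comm]
    have (y : F2 n) : ∑ b : F2 n, (sgn b x : ℂ) * f (x + a) * (starRingEnd ℂ) (g x) *
        ((sgn b y : ℂ) * (starRingEnd ℂ) (k (y + a)) * l y) =
        if y = x then 2 ^ n * (f (x + a) * (starRingEnd ℂ) (g x) *
        ((starRingEnd ℂ) (k (y + a)) * l y)) else 0 := by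
      rw [← ite_zero_mul, ← sum_sgn_mul_sgn, Finset.sum_mul]
      exact Finset.sum_congr rfl fun b _ => by ring
    simp only [this, Finset.sum_ite_eq', Finset.mem_univ, if_true]
    ring
  rw [Fintype.sum_prod_type]
  simp only [inner]
  rw [← Finset.sum_div, Finset.sum_comm]
  have (x : F2 n) : ∑ a : F2 n, f (x + a) * (starRingEnd ℂ) (k (x + a)) *
      ((starRingEnd ℂ) (g x) * l x) =
      (∑ y, f y * (starRingEnd ℂ) (k y)) * ((starRingEnd ℂ) (g x) * l x) := by
    rw [← Equiv.sum_comp (Equiv.addLeft x) (fun y => f y * (starRingEnd ℂ) (k y)), Finset.sum_mul]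
    rfl
  simp only [this, ← Finset.mul_sum]
  rw [corr_conj, corr_eq, corr_eq]
  field_simp
  simp only [mul_comm]

/-- The squared Weyl coefficients `|⟨W_p f, f⟩|²`. -/
def weylSq (f : F2 n → ℂ) (p : F2 n × F2 n) : ℝ := ‖corr (weyl p f) f‖ ^ 2

lemma weylSq_nonneg (f : F2 n → ℂ) (p : F2 n × F2 n) : 0 ≤ weylSq f p := by
  unfold weylSq; positivity

/-- Orthogonality is applied to `f` and `weyl p f`: commuting `weyl q` past `weyl p` costs exactly
the symplectic sign. -/
lemma sum_symp_mul_weylSq (f : F2 n → ℂ) (p : F2 n × F2 n) :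
    ∑ q, symp p q * weylSq f q = 2 ^ n * weylSq f p := by
  have h := sum_weyl_corr_mul_conj f f (weyl p f) (weyl p f)
  have e (q : F2 n × F2 n) : corr (weyl q f) f * (starRingEnd ℂ) (corr (weyl q (weyl p f)) (weyl p f))
      = ((symp p q * weylSq f q : ℝ) : ℂ) := by
    rw [weyl_comm, corr_smul_left, corr_weyl_weyl, map_mul, Complex.conj_ofReal, weylSq, symp_comm]
    push_cast
    rw [← Complex.mul_conj']; ring
  simp only [e] at h
  rw [← Complex.ofReal_sum, Complex.mul_conj', norm_corr_comm] at h
  exact_mod_cast h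

lemma sum_weylSq (f : F2 n → ℂ) : ∑ q, weylSq f q = 2 ^ n * l2norm f ^ 4 := by
  have h := sum_symp_mul_weylSq f 0
  have e : weylSq f 0 = l2norm f ^ 4 := by
    rw [weylSq, weyl_zero, corr_self, Complex.norm_real, Real.norm_eq_abs, sq_abs, ← pow_mul]
  simpa [symp, sgn, e] using h

/-- Convolution becomes squaring on the symplectic Fourier side, where `weylSq f` is self-dual. -/
lemma convDist_eq (f : F2 n → ℂ) (p : F2 n × F2 n) :
    convDist f p = (1 / (2 ^ n * l2norm f ^ 4)) ^ 2 * ∑ r, symp p r * weylSq f r ^ 2 := by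
  have h2 : (2 : ℝ) ^ n ≠ 0 := by positivity
  have e (q : F2 n × F2 n) : charDist f q = 1 / (2 ^ n * l2norm f ^ 4) * weylSq f q := by
    rw [charDist, weylSq, corr_weyl_eq_walsh]
  have inv (q : F2 n × F2 n) : weylSq f q = (∑ r, symp q r * weylSq f r) / 2 ^ n := by
    rw [sum_symp_mul_weylSq]; field_simp
  simp only [convDist, e, sub_eq_add_neg, neg_pair]
  have : ∑ q, weylSq f q * weylSq f (p + q) = ∑ r, symp p r * weylSq f r ^ 2 := by
    calc _ = ∑ q, ∑ r, weylSq f q * (symp p r * symp q r * weylSq f r) / 2 ^ n := by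
          refine Finset.sum_congr rfl fun q _ => ?_
          rw [inv (p + q), ← Finset.sum_div, ← Finset.mul_sum, mul_div_assoc]
          simp only [symp_add_left]
      _ = ∑ r, symp p r * weylSq f r * ((∑ q, symp r q * weylSq f q) / 2 ^ n) := by
          rw [Finset.sum_comm]
          refine Finset.sum_congr rfl fun r _ => ?_
          rw [← mul_div_assoc, ← Finset.sum_div, Finset.mul_sum]
          congr 1
          refine Finset.sum_congr rfl fun q _ => ?_
          rw [symp_comm q r]; ring
      _ = _ := by
          refine Finset.sum_congr rfl fun r _ => ?_
          rw [← inv]; ring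
  rw [← this, Finset.mul_sum]
  exact Finset.sum_congr rfl fun q _ => by ring

lemma corr_le (f g : F2 n → ℂ) : ‖corr f g‖ ^ 2 ≤ l2norm f ^ 2 * l2norm g ^ 2 := by
  have hs (f : F2 n → ℂ) : l2norm f ^ 2 = (∑ x, ‖f x‖ ^ 2) / 2 ^ n := by
    have : ((l2norm f ^ 2 : ℝ) : ℂ) = (((∑ x, ‖f x‖ ^ 2) / 2 ^ n : ℝ) : ℂ) := by
      rw [← corr_self, corr_eq]; push_cast
      simp_rw [Complex.mul_conj']
    exact_mod_cast this
  rw [hs, hs, corr_eq, norm_div, norm_pow, Complex.norm_ofNat, div_pow, div_mul_div_comm, ← sq]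
  gcongr
  calc ‖∑ x, f x * (starRingEnd ℂ) (g x)‖ ^ 2 ≤ (∑ x, ‖f x‖ * ‖g x‖) ^ 2 := by
        gcongr
        exact (norm_sum_le _ _).trans (by simp)
    _ ≤ _ := Finset.sum_mul_sq_le_sq_mul_sq _ _ _

lemma l2norm_nonneg (f : F2 n → ℂ) : 0 ≤ l2norm f := Real.sqrt_nonneg _

lemma l2norm_weyl (p : F2 n × F2 n) (f : F2 n → ℂ) : l2norm (weyl p f) = l2norm f := by
  rw [l2norm, corr_weyl_weyl, l2norm]

lemma weylSq_le (f : F2 n → ℂ) (p : F2 n × F2 n) : weylSq f p ≤ l2norm f ^ 4 := by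
  refine (corr_le _ _).trans_eq ?_
  rw [l2norm_weyl]; ring

/-! ### The U³-norm as a fourth moment of Weyl coefficients -/

lemma sum_walsh_mul_conj (F G : F2 n → ℂ) :
    ∑ k, walsh F k * (starRingEnd ℂ) (walsh G k) = corr F G := by
  have h2 : (2 : ℂ) ^ n ≠ 0 := pow_ne_zero _ two_ne_zero
  simp only [walsh, expect_eq, corr_eq, signChar_eq, map_div₀, map_sum, map_mul, map_pow, map_ofNat,
    Complex.conj_ofReal, div_mul_div_comm, ← Finset.sum_div, Finset.sum_mul_sum]
  rw [div_eq_div_iff (mul_ne_zero h2 h2) h2, Finset.sum_comm, Finset.sum_mul, Finset.sum_mul]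
  refine Finset.sum_congr rfl fun x _ => ?_
  rw [Finset.sum_comm]
  have (y : F2 n) : ∑ b : F2 n, F x * (sgn b x : ℂ) * ((starRingEnd ℂ) (G y) * (sgn b y : ℂ)) =
      if y = x then 2 ^ n * (F x * (starRingEnd ℂ) (G y)) else 0 := by
    rw [← ite_zero_mul, ← sum_sgn_mul_sgn, Finset.sum_mul]
    exact Finset.sum_congr rfl fun b _ => by ring
  simp only [this, Finset.sum_ite_eq', Finset.mem_univ, if_true]
  ring

lemma walsh_translate (F : F2 n → ℂ) (c k : F2 n) :
    walsh (fun x => F (x + c)) k = sgn k c * walsh F k := by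
  rw [walsh, walsh, expect_eq, expect_eq, ← mul_div_assoc, Finset.mul_sum,
    ← Equiv.sum_comp (Equiv.addRight c) (fun x => (sgn k c : ℂ) * (F x * signChar k x))]
  congr 1
  refine Finset.sum_congr rfl fun x _ => ?_
  have := congrArg Complex.ofReal (sgn_mul_self k c)
  push_cast at this
  simp only [signChar_eq, Equiv.coe_addRight, sgn_add_right, Complex.ofReal_mul]
  linear_combination (-F (x + c) * sgn k x) * this

lemma sum_sgn_mul_walsh_sq (F : F2 n → ℂ) (c : F2 n) :
    ∑ k, (sgn k c : ℂ) * (‖walsh F k‖ ^ 2 : ℝ) = (∑ x, mulDeriv c F x) / 2 ^ n := by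
  have h := sum_walsh_mul_conj (fun x => F (x + c)) F
  rw [corr_eq] at h
  rw [show ∑ x, mulDeriv c F x = ∑ x, F (x + c) * (starRingEnd ℂ) (F x) from rfl, ← h]
  refine Finset.sum_congr rfl fun k _ => ?_
  rw [walsh_translate, mul_assoc, Complex.mul_conj']
  push_cast; rfl

/-- With `x + a` as a free variable the left side is the sum over `b` of |∑ₓ Δ_b F(x)|². The inner
sums are the Fourier transform of the squared Walsh coefficients, so Parseval applies. -/
lemma sum_walsh_pow_four (F : F2 n → ℂ) :
    ∑ x, ∑ a, ∑ b, mulDeriv a (mulDeriv b F) x =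
      2 ^ n * 2 ^ n * 2 ^ n * ∑ k, ((‖walsh F k‖ ^ 2 : ℝ) : ℂ) ^ 2 := by
  have h2 : (2 : ℂ) ^ n ≠ 0 := pow_ne_zero _ two_ne_zero
  have e1 : ∑ x, ∑ a, ∑ b, mulDeriv a (mulDeriv b F) x =
      ∑ b, (∑ x, mulDeriv b F x) * (starRingEnd ℂ) (∑ x, mulDeriv b F x) := by
    calc _ = ∑ x, ∑ b, (∑ a, mulDeriv b F (x + a)) * (starRingEnd ℂ) (mulDeriv b F x) := by
          refine Finset.sum_congr rfl fun x _ => ?_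
          rw [Finset.sum_comm]
          refine Finset.sum_congr rfl fun b _ => ?_
          rw [Finset.sum_mul]; rfl
      _ = ∑ x, ∑ b, (∑ y, mulDeriv b F y) * (starRingEnd ℂ) (mulDeriv b F x) := by
          refine Finset.sum_congr rfl fun x _ => Finset.sum_congr rfl fun b _ => ?_
          rw [← Equiv.sum_comp (Equiv.addLeft x) (fun y => mulDeriv b F y)]; rfl
      _ = _ := by
          rw [Finset.sum_comm]
          refine Finset.sum_congr rfl fun b _ => ?_
          rw [map_sum, Finset.mul_sum]
  have e2 (b : F2 n) : ∑ x, mulDeriv b F x =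
      2 ^ n * ∑ k, (sgn k b : ℂ) * (‖walsh F k‖ ^ 2 : ℝ) := by
    rw [sum_sgn_mul_walsh_sq]; field_simp
  have e3 (b : F2 n) : (∑ x, mulDeriv b F x) * (starRingEnd ℂ) (∑ x, mulDeriv b F x) =
      ∑ k, ∑ l, ((2 ^ n * 2 ^ n) * ((‖walsh F k‖ ^ 2 : ℝ) * (‖walsh F l‖ ^ 2 : ℝ))) *
        ((sgn b k : ℂ) * sgn b l) := by
    rw [e2, map_mul, map_pow, map_ofNat, map_sum, mul_mul_mul_comm, Finset.sum_mul_sum,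
      Finset.mul_sum]
    refine Finset.sum_congr rfl fun k _ => ?_
    rw [Finset.mul_sum]
    refine Finset.sum_congr rfl fun l _ => ?_
    rw [map_mul, Complex.conj_ofReal, Complex.conj_ofReal, sgn_comm k, sgn_comm l]; ring
  rw [e1]
  simp only [e3]
  rw [Finset.sum_comm, Finset.mul_sum]
  refine Finset.sum_congr rfl fun k _ => ?_
  rw [Finset.sum_comm]
  simp only [← Finset.mul_sum, sum_sgn_mul_sgn, mul_ite, mul_zero, Finset.sum_ite_eq',
    Finset.mem_univ, if_true]
  ring

lemma gowersU3_eq (f : F2 n → ℂ) :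
    gowersU3 f = ((∑ p, weylSq f p ^ 2) / 2 ^ n) ^ (1 / 8 : ℝ) := by
  have h2 : (2 : ℂ) ^ n ≠ 0 := pow_ne_zero _ two_ne_zero
  have key : (𝔼 x : F2 n, 𝔼 a : F2 n, 𝔼 b : F2 n, 𝔼 c : F2 n,
      mulDeriv a (mulDeriv b (mulDeriv c f)) x) = (((∑ p, weylSq f p ^ 2) / 2 ^ n : ℝ) : ℂ) := by
    simp only [expect_eq, ← Finset.sum_div]
    have e : ∑ x, ∑ a, ∑ b, ∑ c, mulDeriv a (mulDeriv b (mulDeriv c f)) x =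
        ∑ c, ∑ x, ∑ a, ∑ b, mulDeriv a (mulDeriv b (mulDeriv c f)) x := by
      conv_rhs => rw [Finset.sum_comm]
      refine Finset.sum_congr rfl fun x _ => ?_
      conv_rhs => rw [Finset.sum_comm]
      refine Finset.sum_congr rfl fun a _ => ?_
      rw [Finset.sum_comm]
    rw [e]
    simp only [sum_walsh_pow_four]
    rw [← Finset.mul_sum, Fintype.sum_prod_type]
    simp only [weylSq, corr_weyl_eq_walsh]
    push_cast
    field_simp
  rw [gowersU3, key, Complex.ofReal_re]

/-! ### Structure of stabilizer states -/

lemma sum_weylSq_sq_of_isStabilizer {φ : F2 n → ℂ} (hφ : IsStabilizer φ) :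
    ∑ p, weylSq φ p ^ 2 = 2 ^ n := by
  have h0 : 0 ≤ (∑ p, weylSq φ p ^ 2) / 2 ^ n := by positivity
  have h := hφ.2
  rw [gowersU3_eq] at h
  have h := congrArg (fun t : ℝ => t ^ (8 : ℕ)) h
  simp only [one_pow] at h
  rw [← Real.rpow_natCast, ← Real.rpow_mul h0, Nat.cast_ofNat, div_mul_cancel₀ _ (by norm_num),
    Real.rpow_one, div_eq_one_iff_eq (by positivity)] at h
  exact h

lemma weylSq_le_one {φ : F2 n → ℂ} (hφ : l2norm φ = 1) (p : F2 n × F2 n) : weylSq φ p ≤ 1 := by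
  simpa [hφ] using weylSq_le φ p

/-- The reverse inequality is automatic: the coefficients lie in `[0, 1]` and sum to `2 ^ n`. -/
lemma isStabilizer_of_le {φ : F2 n → ℂ} (hφ : l2norm φ = 1)
    (h : 2 ^ n ≤ ∑ p, weylSq φ p ^ 2) : IsStabilizer φ := by
  refine ⟨hφ, ?_⟩
  have h1 : ∑ p, weylSq φ p ^ 2 ≤ ∑ p, weylSq φ p := by
    refine Finset.sum_le_sum fun p _ => ?_
    nlinarith [weylSq_nonneg φ p, weylSq_le_one hφ p]
  rw [sum_weylSq, hφ, one_pow, mul_one] at h1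
  rw [gowersU3_eq, le_antisymm h1 h, div_self (by positivity), Real.one_rpow]

/-- First and second moments agree, so the nonnegative terms `t * (1 - t)` all vanish. -/
lemma weylSq_eq_zero_or_one {φ : F2 n → ℂ} (hφ : IsStabilizer φ) (p : F2 n × F2 n) :
    weylSq φ p = 0 ∨ weylSq φ p = 1 := by
  have h : ∑ p, weylSq φ p * (1 - weylSq φ p) = 0 := by
    have h1 := sum_weylSq_sq_of_isStabilizer hφ
    have h2 := sum_weylSq φ
    rw [hφ.1, one_pow, mul_one] at h2
    simp only [mul_sub, mul_one, Finset.sum_sub_distrib, ← sq, h1, h2, sub_self]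
  rw [Finset.sum_eq_zero_iff_of_nonneg (fun q _ => mul_nonneg (weylSq_nonneg φ q)
    (sub_nonneg.2 (weylSq_le_one hφ.1 q)))] at h
  rcases mul_eq_zero.1 (h p (Finset.mem_univ _)) with h | h
  · exact Or.inl h
  · exact Or.inr (by linarith)

open Classical in
/-- The set `𝓛(φ)` as a finset. -/
def lagr (φ : F2 n → ℂ) : Finset (F2 n × F2 n) := {p | weylSq φ p = 1}

lemma mem_lagr {φ : F2 n → ℂ} {p : F2 n × F2 n} : p ∈ lagr φ ↔ weylSq φ p = 1 := by
  simp [lagr]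

lemma mem_lagrangian {φ : F2 n → ℂ} {p : F2 n × F2 n} : p ∈ lagrangian φ ↔ p ∈ lagr φ := by
  rw [mem_lagr, weylSq, corr_weyl_eq_walsh, lagrangian, Set.mem_ofPred_eq,
    pow_eq_one_iff_of_nonneg (norm_nonneg _) two_ne_zero]

/-- `weylSq φ` is the indicator of `lagr φ`, so self-duality says that this indicator is its own
symplectic transform. Size, isotropy and closure under addition all follow from this. -/
lemma sum_lagr_symp_right {φ : F2 n → ℂ} (hφ : IsStabilizer φ) (w : F2 n × F2 n) :
    ∑ r ∈ lagr φ, symp w r = 2 ^ n * weylSq φ w := by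
  rw [← sum_symp_mul_weylSq, lagr, Finset.sum_filter]
  refine Finset.sum_congr rfl fun r _ => ?_
  rcases weylSq_eq_zero_or_one hφ r with h | h <;> simp [h]

lemma sum_lagr_symp_left {φ : F2 n → ℂ} (hφ : IsStabilizer φ) (w : F2 n × F2 n) :
    ∑ r ∈ lagr φ, symp r w = 2 ^ n * weylSq φ w := by
  simp only [symp_comm _ w, sum_lagr_symp_right hφ]

lemma symp_zero_left (p : F2 n × F2 n) : symp 0 p = 1 := by
  simp [symp, sgn]

lemma weylSq_zero {φ : F2 n → ℂ} (hφ : l2norm φ = 1) : weylSq φ 0 = 1 := by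
  rw [weylSq, weyl_zero, corr_self, hφ]; simp

lemma card_lagr {φ : F2 n → ℂ} (hφ : IsStabilizer φ) : ((lagr φ).card : ℝ) = 2 ^ n := by
  simpa [symp_zero_left, weylSq_zero hφ.1] using sum_lagr_symp_right hφ 0

lemma symp_eq_one_of_mem {φ : F2 n → ℂ} (hφ : IsStabilizer φ) {w r : F2 n × F2 n}
    (hw : w ∈ lagr φ) (hr : r ∈ lagr φ) : symp w r = 1 := by
  have h : ∑ r ∈ lagr φ, (1 - symp w r) = 0 := by
    rw [Finset.sum_sub_distrib, sum_lagr_symp_right hφ, mem_lagr.1 hw]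
    simp [card_lagr hφ]
  rw [Finset.sum_eq_zero_iff_of_nonneg (fun q _ => by
    rcases symp_eq_or w q with h | h <;> rw [h] <;> norm_num)] at h
  linarith [h r hr]

lemma add_mem_lagr {φ : F2 n → ℂ} (hφ : IsStabilizer φ) {w r : F2 n × F2 n}
    (hw : w ∈ lagr φ) (hr : r ∈ lagr φ) : w + r ∈ lagr φ := by
  have h := sum_lagr_symp_right hφ (w + r)
  rw [Finset.sum_congr rfl (g := fun _ => (1 : ℝ)) (fun q hq => by
    rw [symp_add_left, symp_eq_one_of_mem hφ hw hq, symp_eq_one_of_mem hφ hr hq, one_mul])] at h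
  rw [Finset.sum_const, nsmul_eq_mul, mul_one, card_lagr hφ] at h
  rw [mem_lagr]
  have h2 : (2 : ℝ) ^ n ≠ 0 := by positivity
  field_simp at h
  exact h.symm

/-- This is the equality case of Cauchy–Schwarz: φ is a joint eigenvector of the Weyl operators
indexed by `lagr φ`. -/
lemma weyl_eq_smul {φ : F2 n → ℂ} (hφ : IsStabilizer φ) {l : F2 n × F2 n} (hl : l ∈ lagr φ) :
    ∃ c : ℂ, c * (starRingEnd ℂ) c = 1 ∧ weyl l φ = c • φ := by
  set c := corr (weyl l φ) φ with hc
  have h1 : corr φ φ = 1 := by rw [corr_self, hφ.1]; simp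
  have hcc : c * (starRingEnd ℂ) c = 1 := by
    rw [Complex.mul_conj', hc]
    have := mem_lagr.1 hl
    rw [weylSq] at this
    exact_mod_cast this
  refine ⟨c, hcc, ?_⟩
  have : weyl l φ + (-c) • φ = 0 := by
    apply eq_zero_of_corr_self
    rw [corr_add_left, corr_add_right, corr_add_right, corr_smul_left, corr_smul_left,
      corr_smul_right, corr_smul_right, corr_weyl_weyl, h1, ← corr_conj (weyl l φ) φ, ← hc]
    rw [map_neg]
    linear_combination (-1 : ℂ) * hcc
  rw [neg_smul, ← sub_eq_add_neg, sub_eq_zero] at this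
  exact this

/-! ### Coset sums and additive quadruples -/

/-- The cosets `L` and `L + X` are disjoint, and the discarded terms are nonnegative. -/
lemma sum_lagr_add_le {φ : F2 n → ℂ} (hφ : IsStabilizer φ) {X : F2 n × F2 n} (hX : X ∉ lagr φ)
    (F : F2 n × F2 n → ℝ) (hF : ∀ v, 0 ≤ F v) :
    ∑ l ∈ lagr φ, (F l + F (l + X)) ≤ ∑ v, F v := by
  classical
  have hinj : Set.InjOn (fun l => l + X) (lagr φ : Set (F2 n × F2 n)) :=
    (add_left_injective X).injOn
  have hd : Disjoint (lagr φ) ((lagr φ).image fun l => l + X) := by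
    rw [Finset.disjoint_left]
    intro a ha hb
    obtain ⟨l, hl, rfl⟩ := Finset.mem_image.1 hb
    apply hX
    have := add_mem_lagr hφ hl ha
    rwa [← add_assoc, add_self_pair, zero_add] at this
  rw [Finset.sum_add_distrib, ← Finset.sum_image (f := F) hinj, ← Finset.sum_union hd]
  exact Finset.sum_le_sum_of_subset_of_nonneg (Finset.subset_univ _) fun v _ _ => hF v

lemma mul_add_le_sum {φ : F2 n → ℂ} (hφ : IsStabilizer φ) {X : F2 n × F2 n} (hX : X ∉ lagr φ)
    (F : F2 n × F2 n → ℝ) (hF : ∀ v, 0 ≤ F v) (hinv : ∀ v, ∀ l ∈ lagr φ, F (v + l) = F v) :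
    2 ^ n * (F 0 + F X) ≤ ∑ v, F v := by
  refine le_trans (le_of_eq ?_) (sum_lagr_add_le hφ hX F hF)
  rw [Finset.sum_congr rfl (g := fun _ => F 0 + F X) (fun l hl => by
    rw [← hinv 0 l hl, ← hinv X l hl, zero_add, add_comm X])]
  rw [Finset.sum_const, nsmul_eq_mul, card_lagr hφ]

lemma sum_lagr_norm_pow_four {φ : F2 n → ℂ} (hφ : IsStabilizer φ) (g : F2 n × F2 n → ℂ)
    (hg : ∀ v, ∀ l ∈ lagr φ, g (v + l) = g v) :
    ∑ r ∈ lagr φ, ‖∑ v, (symp r v : ℂ) * g v‖ ^ 4 =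
      2 ^ n * 2 ^ n * ∑ v₁, ∑ v₂, ∑ v₃,
        (g v₁ * (starRingEnd ℂ) (g v₂) * g v₃ * (starRingEnd ℂ) (g (v₁ + v₂ + v₃))).re := by
  have hconj (r : F2 n × F2 n) : (starRingEnd ℂ) (∑ v, (symp r v : ℂ) * g v) =
      ∑ v, (symp r v : ℂ) * (starRingEnd ℂ) (g v) := by
    simp only [map_sum, map_mul, Complex.conj_ofReal]
  have hr (r : F2 n × F2 n) : ((‖∑ v, (symp r v : ℂ) * g v‖ ^ 4 : ℝ) : ℂ) =
      ∑ v₁, ∑ v₂, ∑ v₃, ∑ w, (symp r w : ℂ) * (g v₁ * (starRingEnd ℂ) (g v₂) * g v₃ *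
        (starRingEnd ℂ) (g (v₁ + v₂ + v₃ + w))) := by
    have : ((‖∑ v, (symp r v : ℂ) * g v‖ ^ 4 : ℝ) : ℂ) =
        (∑ v, (symp r v : ℂ) * g v) * ((∑ v, (symp r v : ℂ) * (starRingEnd ℂ) (g v)) *
        ((∑ v, (symp r v : ℂ) * g v) * ∑ v, (symp r v : ℂ) * (starRingEnd ℂ) (g v))) := by
      rw [← hconj, ← mul_assoc, Complex.mul_conj']; push_cast; ring
    rw [this, Finset.sum_mul]
    refine Finset.sum_congr rfl fun v₁ _ => ?_
    rw [Finset.sum_mul, Finset.mul_sum]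
    refine Finset.sum_congr rfl fun v₂ _ => ?_
    rw [Finset.sum_mul, Finset.mul_sum, Finset.mul_sum]
    refine Finset.sum_congr rfl fun v₃ _ => ?_
    -- Writing the fourth variable as `v₁ + v₂ + v₃ + w` cancels every sign except that of `w`.
    rw [← Equiv.sum_comp (Equiv.addLeft (v₁ + v₂ + v₃))
      (fun v => (symp r v : ℂ) * (starRingEnd ℂ) (g v))]
    simp only [Finset.mul_sum]
    refine Finset.sum_congr rfl fun w _ => ?_
    have h1 := congrArg Complex.ofReal (symp_mul_self r v₁)
    have h2 := congrArg Complex.ofReal (symp_mul_self r v₂)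
    have h3 := congrArg Complex.ofReal (symp_mul_self r v₃)
    have : (symp r v₁ * symp r v₂ * symp r v₃ * symp r (v₁ + v₂ + v₃ + w) : ℂ) = symp r w := by
      simp only [symp_add_right]
      push_cast at h1 h2 h3 ⊢
      linear_combination (symp r w * (symp r v₂ * symp r v₂) * (symp r v₃ * symp r v₃) : ℂ) * h1 +
        (symp r w * (symp r v₃ * symp r v₃) : ℂ) * h2 + (symp r w : ℂ) * h3
    rw [← this, Equiv.coe_addLeft]
    ring
  -- Summing over `r` confines `w` to `lagr φ`, and there invariance of `g` removes `w`.
  have hw (u : F2 n × F2 n) (z : ℂ) : ∑ w, ∑ r ∈ lagr φ, (symp r w : ℂ) *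
      (z * (starRingEnd ℂ) (g (u + w))) = 2 ^ n * 2 ^ n * (z * (starRingEnd ℂ) (g u)) := by
    have (w : F2 n × F2 n) : ∑ r ∈ lagr φ, (symp r w : ℂ) * (z * (starRingEnd ℂ) (g (u + w))) =
        if w ∈ lagr φ then 2 ^ n * (z * (starRingEnd ℂ) (g u)) else 0 := by
      have e := congrArg Complex.ofReal (sum_lagr_symp_left hφ w)
      push_cast at e
      rw [← Finset.sum_mul, e]
      split_ifs with h
      · rw [mem_lagr.1 h, hg u w h]; simp
      · rw [(weylSq_eq_zero_or_one hφ w).resolve_right (fun h' => h (mem_lagr.2 h'))]; simp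
    simp only [this]
    have hcard := congrArg Complex.ofReal (card_lagr hφ)
    push_cast at hcard
    rw [Finset.sum_ite_mem, Finset.univ_inter, Finset.sum_const, nsmul_eq_mul, hcard, mul_assoc]
  have main : ((∑ r ∈ lagr φ, ‖∑ v, (symp r v : ℂ) * g v‖ ^ 4 : ℝ) : ℂ) =
      2 ^ n * 2 ^ n * ∑ v₁, ∑ v₂, ∑ v₃,
        (g v₁ * (starRingEnd ℂ) (g v₂) * g v₃ * (starRingEnd ℂ) (g (v₁ + v₂ + v₃))) := by
    rw [Complex.ofReal_sum]
    simp only [hr]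
    rw [Finset.sum_comm, Finset.mul_sum]
    refine Finset.sum_congr rfl fun v₁ _ => ?_
    rw [Finset.sum_comm, Finset.mul_sum]
    refine Finset.sum_congr rfl fun v₂ _ => ?_
    rw [Finset.sum_comm, Finset.mul_sum]
    refine Finset.sum_congr rfl fun v₃ _ => ?_
    rw [Finset.sum_comm, hw]
  have := congrArg Complex.re main
  rw [Complex.ofReal_re] at this
  rw [this]
  have h2 : (2 ^ n * 2 ^ n : ℂ) = ((2 ^ n * 2 ^ n : ℝ) : ℂ) := by push_cast; rfl
  rw [h2, Complex.re_ofReal_mul]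
  simp only [Complex.re_sum]

/-- Individual terms may be negative, but pairing each quadruple with its translate by `X` gives `P
+ R - 2 Re G` with `|G|² = P R`, nonnegative by AM-GM. Only quadruples in the cosets of `0` and `X`
are then kept. -/
lemma le_sum_quadruple {φ : F2 n → ℂ} (hφ : IsStabilizer φ) {X : F2 n × F2 n} (hX : X ∉ lagr φ)
    (A : F2 n × F2 n → ℝ) (g : F2 n × F2 n → ℂ) (s : ℝ) (hs : s * s = 1)
    (hA : ∀ v, 0 ≤ A v) (hAinv : ∀ v, ∀ l ∈ lagr φ, A (v + l) = A v)
    (hginv : ∀ v, ∀ l ∈ lagr φ, g (v + l) = g v)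
    (hgX : ∀ v, g (v + X) = s * (starRingEnd ℂ) (g v))
    (hgA : ∀ v, ‖g v‖ ^ 2 = A v * A (v + X)) :
    2 ^ n * 2 ^ n * 2 ^ n * (A 0 ^ 4 + A X ^ 4 - 2 * (g 0 ^ 4).re) ≤
      ∑ v₁, ∑ v₂, ∑ v₃, (A v₁ * A v₂ * A v₃ * A (v₁ + v₂ + v₃) -
        (g v₁ * (starRingEnd ℂ) (g v₂) * g v₃ * (starRingEnd ℂ) (g (v₁ + v₂ + v₃))).re) := by
  set T : F2 n × F2 n → F2 n × F2 n → F2 n × F2 n → ℝ := fun v₁ v₂ v₃ =>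
    A v₁ * A v₂ * A v₃ * A (v₁ + v₂ + v₃) -
      (g v₁ * (starRingEnd ℂ) (g v₂) * g v₃ * (starRingEnd ℂ) (g (v₁ + v₂ + v₃))).re with hT
  set T' : F2 n × F2 n → F2 n × F2 n → F2 n × F2 n → ℝ := fun v₁ v₂ v₃ =>
    A v₁ * A v₂ * A v₃ * A (v₁ + v₂ + v₃) +
      A (v₁ + X) * A (v₂ + X) * A (v₃ + X) * A (v₁ + v₂ + v₃ + X) -
      2 * (g v₁ * (starRingEnd ℂ) (g v₂) * g v₃ * (starRingEnd ℂ) (g (v₁ + v₂ + v₃))).re with hT'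
  have hsum : ∑ v₁, ∑ v₂, ∑ v₃, T' v₁ v₂ v₃ = 2 * ∑ v₁, ∑ v₂, ∑ v₃, T v₁ v₂ v₃ := by
    have hshift (v₁ v₂ v₃ : F2 n × F2 n) :
        T' v₁ v₂ v₃ = T v₁ v₂ v₃ + T (v₁ + X) (v₂ + X) (v₃ + X) := by
      have e : v₁ + X + (v₂ + X) + (v₃ + X) = v₁ + v₂ + v₃ + X := by
        have := add_self_pair X
        linear_combination (exp := 1) this
      have hs' : (s : ℂ) * s = 1 := by exact_mod_cast hs
      have e2 : s * (starRingEnd ℂ) (g v₁) * (starRingEnd ℂ) (s * (starRingEnd ℂ) (g v₂)) *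
          (s * (starRingEnd ℂ) (g v₃)) *
          (starRingEnd ℂ) (s * (starRingEnd ℂ) (g (v₁ + v₂ + v₃))) =
          (starRingEnd ℂ) (g v₁ * (starRingEnd ℂ) (g v₂) * g v₃ *
            (starRingEnd ℂ) (g (v₁ + v₂ + v₃))) := by
        simp only [map_mul, Complex.conj_ofReal, Complex.conj_conj]
        linear_combination ((starRingEnd ℂ) (g v₁) * g v₂ * (starRingEnd ℂ) (g v₃) *
          g (v₁ + v₂ + v₃)) * (s * s + 1) * hs'
      simp only [hT, hT', e, hgX, e2, Complex.conj_re]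
      ring
    simp only [hshift, Finset.sum_add_distrib]
    rw [two_mul]
    congr 1
    rw [← Equiv.sum_comp (Equiv.addRight X) (fun v₁ => ∑ v₂, ∑ v₃, T v₁ v₂ v₃)]
    refine Finset.sum_congr rfl fun v₁ _ => ?_
    rw [← Equiv.sum_comp (Equiv.addRight X) (fun v₂ => ∑ v₃, T _ v₂ v₃)]
    refine Finset.sum_congr rfl fun v₂ _ => ?_
    rw [← Equiv.sum_comp (Equiv.addRight X) (fun v₃ => T _ _ v₃)]
    rfl
  have hpos (v₁ v₂ v₃ : F2 n × F2 n) : 0 ≤ T' v₁ v₂ v₃ := by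
    simp only [hT']
    set G := g v₁ * (starRingEnd ℂ) (g v₂) * g v₃ * (starRingEnd ℂ) (g (v₁ + v₂ + v₃)) with hG
    set P := A v₁ * A v₂ * A v₃ * A (v₁ + v₂ + v₃)
    set R := A (v₁ + X) * A (v₂ + X) * A (v₃ + X) * A (v₁ + v₂ + v₃ + X)
    have hP : 0 ≤ P := mul_nonneg (mul_nonneg (mul_nonneg (hA _) (hA _)) (hA _)) (hA _)
    have hR : 0 ≤ R := mul_nonneg (mul_nonneg (mul_nonneg (hA _) (hA _)) (hA _)) (hA _)
    have hn : ‖G‖ ^ 2 = P * R := by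
      simp only [hG, norm_mul, RCLike.norm_conj, mul_pow, hgA, P, R]; ring
    have : ‖G‖ ≤ (P + R) / 2 := by
      apply le_of_sq_le_sq _ (by positivity)
      nlinarith [sq_nonneg (P - R)]
    linarith [Complex.re_le_norm G]
  have add3 (a b c l : F2 n × F2 n) : a + l + b + c = a + b + c + l := by abel
  have add2 (a b c l : F2 n × F2 n) : a + (b + l) + c = a + b + c + l := by abel
  have add1 (a b c l : F2 n × F2 n) : a + b + (c + l) = a + b + c + l := by abel
  have hA2 (v) (l) (hl : l ∈ lagr φ) : A (v + l + X) = A (v + X) := by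
    rw [add_right_comm, hAinv _ _ hl]
  have i1 (v₁ v₂ v₃ : F2 n × F2 n) (l) (hl : l ∈ lagr φ) : T' (v₁ + l) v₂ v₃ = T' v₁ v₂ v₃ := by
    simp only [hT', add3, hAinv _ _ hl, hginv _ _ hl, hA2 _ _ hl]
  have i2 (v₁ v₂ v₃ : F2 n × F2 n) (l) (hl : l ∈ lagr φ) : T' v₁ (v₂ + l) v₃ = T' v₁ v₂ v₃ := by
    simp only [hT', add2, hAinv _ _ hl, hginv _ _ hl, hA2 _ _ hl]
  have i3 (v₁ v₂ v₃ : F2 n × F2 n) (l) (hl : l ∈ lagr φ) : T' v₁ v₂ (v₃ + l) = T' v₁ v₂ v₃ := by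
    simp only [hT', add1, hAinv _ _ hl, hginv _ _ hl, hA2 _ _ hl]
  have b3 (v₁ v₂ : F2 n × F2 n) := mul_add_le_sum hφ hX (T' v₁ v₂) (hpos v₁ v₂)
    fun v l hl => i3 v₁ v₂ v l hl
  have b2 (v₁ : F2 n × F2 n) := mul_add_le_sum hφ hX (fun v₂ => ∑ v₃, T' v₁ v₂ v₃)
    (fun v₂ => Finset.sum_nonneg fun v₃ _ => hpos v₁ v₂ v₃)
    fun v l hl => Finset.sum_congr rfl fun v₃ _ => i2 v₁ v v₃ l hl
  have b1 := mul_add_le_sum hφ hX (fun v₁ => ∑ v₂, ∑ v₃, T' v₁ v₂ v₃)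
    (fun v₁ => Finset.sum_nonneg fun v₂ _ => Finset.sum_nonneg fun v₃ _ => hpos v₁ v₂ v₃)
    fun v l hl => Finset.sum_congr rfl fun v₂ _ => Finset.sum_congr rfl fun v₃ _ => i1 v v₂ v₃ l hl
  have hN : (0 : ℝ) ≤ 2 ^ n := by positivity
  have c2 (v₁ : F2 n × F2 n) : 2 ^ n * (2 ^ n * (T' v₁ 0 0 + T' v₁ 0 X) +
      2 ^ n * (T' v₁ X 0 + T' v₁ X X)) ≤ ∑ v₂, ∑ v₃, T' v₁ v₂ v₃ :=
    (mul_le_mul_of_nonneg_left (add_le_add (b3 v₁ 0) (b3 v₁ X)) hN).trans (b2 v₁)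
  have c1 := (mul_le_mul_of_nonneg_left (add_le_add (c2 0) (c2 X)) hN).trans b1
  rw [hsum] at c1
  -- Of the eight coset choices, `000` and `XXX` each give `(A 0 ^ 2 - A X ^ 2) ^ 2`, `0X0` and
  -- `X0X` supply the real part of `g 0 ^ 4`, and the others vanish.
  suffices hval : (T' 0 0 0 + T' 0 0 X) + (T' 0 X 0 + T' 0 X X) + ((T' X 0 0 + T' X 0 X) +
      (T' X X 0 + T' X X X)) = 2 * (A 0 ^ 4 + A X ^ 4 - 2 * (g 0 ^ 4).re) by
    have : 2 ^ n * 2 ^ n * 2 ^ n * ((T' 0 0 0 + T' 0 0 X) + (T' 0 X 0 + T' 0 X X) +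
        ((T' X 0 0 + T' X 0 X) + (T' X X 0 + T' X X X))) ≤ 2 * ∑ v₁, ∑ v₂, ∑ v₃, T v₁ v₂ v₃ :=
      le_trans (le_of_eq (by ring)) c1
    rw [hval] at this
    linarith
  have hgX0 : g X = s * (starRingEnd ℂ) (g 0) := by rw [← hgX, zero_add]
  have hg0 := hgA 0
  rw [zero_add, Complex.sq_norm, Complex.normSq_apply] at hg0
  simp only [hT', zero_add, add_zero, add_self_pair, hgX0]
  simp only [map_mul, Complex.conj_ofReal, Complex.conj_conj, pow_succ, pow_zero, one_mul,
    Complex.mul_re, Complex.mul_im, Complex.ofReal_re, Complex.ofReal_im, Complex.conj_re,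
    Complex.conj_im]
  rcases mul_self_eq_one_iff.1 hs with rfl | rfl <;>
  linear_combination (-12 * (A 0 * A X + (g 0).re * (g 0).re + (g 0).im * (g 0).im)) * hg0

/-! ### Symplectic characters and the mass of half of 𝓛(φ) -/

lemma exists_symp_eq (ℓ : F2 n × F2 n →ₗ[ZMod 2] ZMod 2) :
    ∃ X : F2 n × F2 n, ∀ p, symp X p = (-1 : ℝ) ^ (ℓ p).val := by
  refine ⟨(fun i => ℓ (0, fun j => if i = j then 1 else 0),
    fun i => ℓ (fun j => if i = j then 1 else 0, 0)), fun p => ?_⟩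
  have h1 := LinearMap.pi_apply_eq_sum_univ (ℓ ∘ₗ LinearMap.inl (ZMod 2) (F2 n) (F2 n)) p.1
  have h2 := LinearMap.pi_apply_eq_sum_univ (ℓ ∘ₗ LinearMap.inr (ZMod 2) (F2 n) (F2 n)) p.2
  have h : ℓ p = ℓ (p.1, 0) + ℓ (0, p.2) := by rw [← map_add]; simp
  simp only [LinearMap.comp_apply, LinearMap.inl_apply, LinearMap.inr_apply, smul_eq_mul] at h1 h2
  rw [h, h1, h2, neg_one_pow_val_add, symp, sgn_comm]
  rfl

lemma convMass_mono (f : F2 n → ℂ) {S T : Set (F2 n × F2 n)} (h : S ⊆ T) :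
    convMass f S ≤ convMass f T := by
  refine Finset.sum_le_sum fun p _ => Set.indicator_le_indicator_of_subset h (fun q => ?_) p
  exact Finset.sum_nonneg fun r _ => by unfold charDist; positivity

lemma convMass_inter_add_diff (f : F2 n → ℂ) (S T : Set (F2 n × F2 n)) :
    convMass f (S ∩ T) + convMass f (S \ T) = convMass f S := by
  rw [convMass, convMass, convMass, ← Finset.sum_add_distrib]
  refine Finset.sum_congr rfl fun p _ => ?_
  by_cases hS : p ∈ S <;> by_cases hT : p ∈ T <;> simp [hS, hT]

/-- The half is cut out by `(1 - symp X p) / 2`. Summing the Fourier formula for `convDist` over it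
gives, by self-duality of `lagr φ`, the indicator of `L` minus that of `L + X`. -/
lemma convMass_lagrangian_symp {φ : F2 n → ℂ} (hφ : IsStabilizer φ) (f : F2 n → ℂ)
    (X : F2 n × F2 n) :
    convMass f {p | p ∈ lagr φ ∧ symp X p = -1} =
      (1 / (2 ^ n * l2norm f ^ 4)) ^ 2 * (2 ^ n / 2) *
        ∑ r ∈ lagr φ, (weylSq f r ^ 2 - weylSq f (r + X) ^ 2) := by
  classical
  have h1 : convMass f {p | p ∈ lagr φ ∧ symp X p = -1} =
      ∑ p ∈ lagr φ, (1 - symp X p) / 2 * convDist f p := by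
    rw [convMass, ← Finset.sum_filter_add_sum_filter_not Finset.univ (· ∈ lagr φ),
      Finset.filter_mem_eq_inter, Finset.univ_inter, Finset.sum_eq_zero (s := Finset.filter _ _),
      add_zero]
    · refine Finset.sum_congr rfl fun p hp => ?_
      rcases symp_eq_or X p with h | h
      · rw [Set.indicator_of_notMem (by rintro ⟨-, h'⟩; rw [h] at h'; norm_num at h'), h]; simp
      · rw [Set.indicator_of_mem (Set.mem_ofPred_eq ▸ ⟨hp, h⟩), h]; norm_num
    · intro p hp
      exact Set.indicator_of_notMem (fun h => (Finset.mem_filter.1 hp).2 h.1) _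
  have h2 : ∑ p ∈ lagr φ, (1 - symp X p) * ∑ r, symp p r * weylSq f r ^ 2 =
      2 ^ n * ∑ r ∈ lagr φ, (weylSq f r ^ 2 - weylSq f (r + X) ^ 2) := by
    calc _ = ∑ r, (2 ^ n * weylSq φ r - 2 ^ n * weylSq φ (r + X)) * weylSq f r ^ 2 := by
          simp only [← sum_lagr_symp_left hφ, ← Finset.sum_sub_distrib, Finset.mul_sum,
            Finset.sum_mul]
          rw [Finset.sum_comm]
          refine Finset.sum_congr rfl fun r _ => Finset.sum_congr rfl fun p _ => ?_
          rw [symp_add_right, symp_comm X]; ring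
      _ = 2 ^ n * ∑ r, weylSq φ r * (weylSq f r ^ 2 - weylSq f (r + X) ^ 2) := by
          simp only [sub_mul, mul_sub, Finset.sum_sub_distrib]
          congr 1
          · rw [Finset.mul_sum]; exact Finset.sum_congr rfl fun r _ => by ring
          · rw [← Equiv.sum_comp (Equiv.addRight X), Finset.mul_sum]
            refine Finset.sum_congr rfl fun r _ => ?_
            rw [Equiv.coe_addRight, add_assoc, add_self_pair, add_zero]; ring
      _ = _ := by
          congr 1
          rw [lagr, Finset.sum_filter]
          refine Finset.sum_congr rfl fun r _ => ?_
          rcases weylSq_eq_zero_or_one hφ r with h | h <;> simp [h]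
  rw [h1]
  simp only [convDist_eq]
  rw [mul_assoc, div_mul_eq_mul_div, ← h2, ← mul_div_assoc, Finset.mul_sum, Finset.sum_div]
  exact Finset.sum_congr rfl fun p _ => by ring

/-! ### Lower bound from the Weyl frame of φ -/

lemma sum_corr_weyl_mul_conj {φ : F2 n → ℂ} (hφ : l2norm φ = 1) (u w : F2 n → ℂ) :
    ∑ v, corr u (weyl v φ) * (starRingEnd ℂ) (corr w (weyl v φ)) = 2 ^ n * corr u w := by
  have h := congrArg (starRingEnd ℂ) (sum_weyl_corr_mul_conj φ u φ w)
  simp only [map_sum, map_mul, corr_conj, map_pow, map_ofNat] at h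
  rw [corr_self, hφ] at h
  simp only [corr_conj, h]
  simp

/-- The translates `weyl v φ` form a tight frame diagonalizing `weyl r`, with eigenvalues `symp r v`
up to a common phase. -/
lemma exists_corr_weyl_eq_sum {φ : F2 n → ℂ} (hφ : IsStabilizer φ) {r : F2 n × F2 n}
    (hr : r ∈ lagr φ) : ∃ e : ℂ, ‖e‖ = 1 ∧ ∀ u w, 2 ^ n * corr (weyl r u) w =
      e * ∑ v, (symp r v : ℂ) * (corr u (weyl v φ) * (starRingEnd ℂ) (corr w (weyl v φ))) := by
  obtain ⟨c, hc, h⟩ := weyl_eq_smul hφ hr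
  have hc' : ‖c‖ = 1 := by
    rw [Complex.mul_conj'] at hc
    exact (pow_eq_one_iff_of_nonneg (norm_nonneg _) two_ne_zero).1 (by exact_mod_cast hc)
  refine ⟨sgn r.2 r.1 * (starRingEnd ℂ) c, ?_, fun u w => ?_⟩
  · rw [norm_mul, RCLike.norm_conj, hc']
    rcases sgn_eq_or r.2 r.1 with h | h <;> simp [h]
  · rw [← sum_corr_weyl_mul_conj hφ.1, Finset.mul_sum]
    refine Finset.sum_congr rfl fun v _ => ?_
    rw [corr_weyl_left, weyl_comm, h, weyl_smul, smul_smul, corr_smul_right, map_mul,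
      Complex.conj_ofReal]
    ring

/-- In the frame, coefficients on `L` are transforms of `A` and those on `L + X` are transforms of
`g`, up to phase and scale. Their fourth moments are the two quadruple sums compared in
`le_sum_quadruple`. -/
lemma le_sum_weylSq {φ : F2 n → ℂ} (hφ : IsStabilizer φ) {X : F2 n × F2 n} (hX : X ∉ lagr φ)
    (f : F2 n → ℂ) :
    2 ^ n * ((‖corr f φ‖ ^ 2) ^ 4 + (‖corr f (weyl X φ)‖ ^ 2) ^ 4 -
        2 * ((corr f φ * (starRingEnd ℂ) (corr f (weyl X φ))) ^ 4).re) ≤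
      ∑ r ∈ lagr φ, (weylSq f r ^ 2 - weylSq f (r + X) ^ 2) := by
  set A : F2 n × F2 n → ℝ := fun v => ‖corr f (weyl v φ)‖ ^ 2 with hA
  set g : F2 n × F2 n → ℂ := fun v =>
    corr (weyl X f) (weyl v φ) * (starRingEnd ℂ) (corr f (weyl v φ)) with hg
  set s := sgn X.2 X.1 with hs
  have hss : s * s = 1 := sgn_mul_self _ _
  have hssC : (s : ℂ) * s = 1 := by exact_mod_cast hss
  have hN : (2 : ℝ) ^ n ≠ 0 := by positivity
  have inv (v l : F2 n × F2 n) (hl : l ∈ lagr φ) :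
      ∃ c : ℂ, c * (starRingEnd ℂ) c = 1 ∧ weyl (v + l) φ = c • weyl v φ := by
    obtain ⟨c, hc, h⟩ := weyl_eq_smul hφ hl
    refine ⟨sgn l.2 v.1 * c, ?_, ?_⟩
    · have : (sgn l.2 v.1 : ℂ) * sgn l.2 v.1 = 1 := by exact_mod_cast sgn_mul_self _ _
      rw [map_mul, Complex.conj_ofReal]
      linear_combination (sgn l.2 v.1 * sgn l.2 v.1 : ℂ) * hc + this
    · rw [weyl_add_index, h, weyl_smul, smul_smul]
  have invprod (u w : F2 n → ℂ) (v l : F2 n × F2 n) (hl : l ∈ lagr φ) :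
      corr u (weyl (v + l) φ) * (starRingEnd ℂ) (corr w (weyl (v + l) φ)) =
        corr u (weyl v φ) * (starRingEnd ℂ) (corr w (weyl v φ)) := by
    obtain ⟨c, hc, h⟩ := inv v l hl
    rw [h, corr_smul_right, corr_smul_right, map_mul, Complex.conj_conj]
    linear_combination (corr u (weyl v φ) * (starRingEnd ℂ) (corr w (weyl v φ))) * hc
  have hAC (v : F2 n × F2 n) : (A v : ℂ) =
      corr f (weyl v φ) * (starRingEnd ℂ) (corr f (weyl v φ)) := by
    rw [Complex.mul_conj', hA]; push_cast; rfl
  have hginv (v) (l) (hl : l ∈ lagr φ) : g (v + l) = g v := invprod _ _ v l hl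
  have hAinv (v) (l) (hl : l ∈ lagr φ) : A (v + l) = A v := by
    have := invprod f f v l hl
    rw [← hAC, ← hAC] at this
    exact_mod_cast this
  have hgX (v : F2 n × F2 n) : g (v + X) = s * (starRingEnd ℂ) (g v) := by
    have ht : (sgn v.2 X.1 : ℂ) * sgn v.2 X.1 = 1 := by exact_mod_cast sgn_mul_self _ _
    have e : corr f (weyl X (weyl v φ)) = s * corr (weyl X f) (weyl v φ) := by
      rw [corr_weyl_left, ← mul_assoc, hssC, one_mul]
    simp only [hg]
    rw [add_comm v X, weyl_add_index, corr_smul_right, corr_smul_right, corr_weyl_weyl, e]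
    simp only [map_mul, Complex.conj_ofReal, Complex.conj_conj]
    linear_combination (s * corr f (weyl v φ) * (starRingEnd ℂ) (corr (weyl X f) (weyl v φ))) * ht
  have hnorm (b x : F2 n) : ‖(sgn b x : ℂ)‖ = 1 := by
    rcases sgn_eq_or b x with h | h <;> simp [h]
  have hgA (v : F2 n × F2 n) : ‖g v‖ ^ 2 = A v * A (v + X) := by
    simp only [hg, hA]
    rw [norm_mul, RCLike.norm_conj, mul_pow, mul_comm, corr_weyl_left, add_comm v X,
      weyl_add_index, corr_smul_right, Complex.conj_ofReal, norm_mul, norm_mul, hnorm, hnorm]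
  have key := le_sum_quadruple hφ hX A g s hss (fun v => by positivity) hAinv hginv hgX hgA
  have e1 := sum_lagr_norm_pow_four hφ (fun v => (A v : ℂ)) fun v l hl => by rw [hAinv v l hl]
  have e2 := sum_lagr_norm_pow_four hφ g hginv
  have e3 (r) (hr : r ∈ lagr φ) : (2 ^ n) ^ 4 * weylSq f r ^ 2 =
      ‖∑ v, (symp r v : ℂ) * (A v : ℂ)‖ ^ 4 := by
    obtain ⟨e, he, h⟩ := exists_corr_weyl_eq_sum hφ hr
    have := congrArg (‖·‖ ^ 4) (h f f)
    simp only [norm_mul, he, norm_pow, Complex.norm_ofNat, one_mul] at this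
    simp only [hAC]
    rw [← this, weylSq]; ring
  have e4 (r) (hr : r ∈ lagr φ) : (2 ^ n) ^ 4 * weylSq f (r + X) ^ 2 =
      ‖∑ v, (symp r v : ℂ) * g v‖ ^ 4 := by
    obtain ⟨e, he, h⟩ := exists_corr_weyl_eq_sum hφ hr
    have := congrArg (‖·‖ ^ 4) (h (weyl X f) f)
    simp only [norm_mul, he, norm_pow, Complex.norm_ofNat, one_mul] at this
    rw [← this, weylSq, weyl_add_index, corr_smul_left, norm_mul, hnorm]; ring
  have hsum : (2 ^ n) ^ 4 * ∑ r ∈ lagr φ, (weylSq f r ^ 2 - weylSq f (r + X) ^ 2) =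
      2 ^ n * 2 ^ n * ∑ v₁, ∑ v₂, ∑ v₃, (A v₁ * A v₂ * A v₃ * A (v₁ + v₂ + v₃) -
        (g v₁ * (starRingEnd ℂ) (g v₂) * g v₃ * (starRingEnd ℂ) (g (v₁ + v₂ + v₃))).re) := by
    simp only [Finset.sum_sub_distrib, mul_sub, Finset.mul_sum (s := lagr φ)]
    rw [Finset.sum_congr rfl e3, Finset.sum_congr rfl e4, e1, e2]
    simp only [Complex.conj_ofReal, ← Complex.ofReal_mul, Complex.ofReal_re]
  have hg0 : (g 0 ^ 4).re =
      ((corr f φ * (starRingEnd ℂ) (corr f (weyl X φ))) ^ 4).re := by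
    have : g 0 ^ 4 = (starRingEnd ℂ) ((corr f φ * (starRingEnd ℂ) (corr f (weyl X φ))) ^ 4) := by
      simp only [hg, weyl_zero]
      rw [corr_weyl_left, ← hs]
      simp only [map_mul, map_pow, Complex.conj_conj]
      linear_combination (corr f (weyl X φ) * (starRingEnd ℂ) (corr f φ)) ^ 4 *
        (s * s + 1) * hssC
    rw [this, Complex.conj_re]
  have hA0 : A 0 = ‖corr f φ‖ ^ 2 := by simp only [hA, weyl_zero]
  rw [hg0, hA0] at key
  have h4 : (0 : ℝ) < (2 ^ n) ^ 4 := by positivity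
  refine le_of_mul_le_mul_left ?_ h4
  rw [hsum]
  refine le_trans (le_of_eq ?_) (mul_le_mul_of_nonneg_left key (by positivity : (0 : ℝ) ≤ 2 ^ n * 2 ^ n))
  ring

/-! ### Neighbouring stabilizer states -/

lemma weylSq_smul (c : ℂ) (f : F2 n → ℂ) (p : F2 n × F2 n) :
    weylSq (c • f) p = ‖c‖ ^ 4 * weylSq f p := by
  rw [weylSq, weylSq, weyl_smul, corr_smul_left, corr_smul_right, norm_mul, norm_mul,
    RCLike.norm_conj]
  ring

lemma corr_weyl_eq_zero {φ : F2 n → ℂ} (hφ : IsStabilizer φ) {X : F2 n × F2 n}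
    (hX : X ∉ lagr φ) : corr (weyl X φ) φ = 0 := by
  have h := (weylSq_eq_zero_or_one hφ X).resolve_right fun h => hX (mem_lagr.2 h)
  simpa [weylSq] using h

/-- The normalized superposition of `φ` and its Weyl translate with relative phase `μ`. -/
def neighbor (φ : F2 n → ℂ) (X : F2 n × F2 n) (μ : ℂ) : F2 n → ℂ :=
  ((1 / Real.sqrt 2 : ℝ) : ℂ) • (φ + μ • weyl X φ)

lemma norm_inv_sqrt_two : ‖((1 / Real.sqrt 2 : ℝ) : ℂ)‖ ^ 2 = 1 / 2 := by
  rw [Complex.norm_real, Real.norm_eq_abs, sq_abs, div_pow, Real.sq_sqrt (by norm_num), one_pow]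

lemma norm_corr_neighbor_sq (f φ : F2 n → ℂ) (X : F2 n × F2 n) (μ : ℂ) :
    ‖corr f (neighbor φ X μ)‖ ^ 2 =
      1 / 2 * ‖corr f φ + (starRingEnd ℂ) μ * corr f (weyl X φ)‖ ^ 2 := by
  rw [neighbor, corr_smul_right, norm_mul, mul_pow, RCLike.norm_conj, norm_inv_sqrt_two,
    corr_add_right, corr_smul_right]

lemma norm_corr_self_neighbor {φ : F2 n → ℂ} (hφ : IsStabilizer φ) {X : F2 n × F2 n}
    (hX : X ∉ lagr φ) (μ : ℂ) : ‖corr φ (neighbor φ X μ)‖ ^ 2 = 1 / 2 := by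
  rw [norm_corr_neighbor_sq, ← corr_conj (weyl X φ), corr_weyl_eq_zero hφ hX, corr_self, hφ.1]
  simp

/-- The coefficients on `L ∪ (L + X)` already have second moment `2 ^ n`. The condition on `μ ^ 2`
makes the sign `σ` real. -/
lemma isStabilizer_neighbor {φ : F2 n → ℂ} (hφ : IsStabilizer φ) {X : F2 n × F2 n}
    (hX : X ∉ lagr φ) {μ : ℂ} (hμ : μ * (starRingEnd ℂ) μ = 1) (hμ2 : μ ^ 2 = 1 ∨ μ ^ 2 = -1) :
    IsStabilizer (neighbor φ X μ) := by
  have h0 := corr_weyl_eq_zero hφ hX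
  have h0' : corr φ (weyl X φ) = 0 := by rw [← corr_conj, h0, map_zero]
  have h1 : corr φ φ = 1 := by rw [corr_self, hφ.1]; simp
  have hself : corr (φ + μ • weyl X φ) (φ + μ • weyl X φ) = 2 := by
    simp only [corr_add_left, corr_add_right, corr_smul_left, corr_smul_right, corr_weyl_weyl,
      h0, h0', h1]
    linear_combination hμ
  have hnorm : l2norm (neighbor φ X μ) = 1 := by
    rw [l2norm, neighbor, corr_smul_left, corr_smul_right, hself, ← mul_assoc, Complex.mul_conj',
      ← Complex.ofReal_pow, norm_inv_sqrt_two]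
    norm_num
  obtain ⟨σ, hσ, hσ2⟩ : ∃ σ : ℝ, (σ = 1 ∨ σ = -1) ∧ μ ^ 2 * sgn X.2 X.1 = σ := by
    rcases hμ2 with h | h <;> rcases sgn_eq_or X.2 X.1 with h' | h' <;> rw [h, h']
    exacts [⟨1, by simp⟩, ⟨-1, by simp⟩, ⟨-1, by simp⟩, ⟨1, by simp⟩]
  have hμn : ‖μ‖ = 1 := by
    rw [Complex.mul_conj'] at hμ
    exact (pow_eq_one_iff_of_nonneg (norm_nonneg _) two_ne_zero).1 (by exact_mod_cast hμ)
  have hscale (p : F2 n × F2 n) : weylSq (neighbor φ X μ) p =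
      1 / 4 * weylSq (φ + μ • weyl X φ) p := by
    rw [neighbor, weylSq_smul, show 4 = 2 * 2 from rfl, pow_mul, norm_inv_sqrt_two]
    norm_num
  have hact (r) (hr : r ∈ lagr φ) : ∃ c : ℂ, ‖c‖ = 1 ∧
      weyl r (φ + μ • weyl X φ) = c • (φ + (symp r X * μ) • weyl X φ) := by
    obtain ⟨c, hc, h⟩ := weyl_eq_smul hφ hr
    refine ⟨c, ?_, ?_⟩
    · rw [Complex.mul_conj'] at hc
      exact (pow_eq_one_iff_of_nonneg (norm_nonneg _) two_ne_zero).1 (by exact_mod_cast hc)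
    · rw [weyl_add, weyl_smul, weyl_comm, h, weyl_smul, smul_add, smul_smul, smul_smul, smul_smul]
      congr 2; ring
  have hL (r) (hr : r ∈ lagr φ) : weylSq (neighbor φ X μ) r ^ 2 = (1 + symp r X) / 2 := by
    obtain ⟨c, hc, h⟩ := hact r hr
    have : corr (φ + (symp r X * μ) • weyl X φ) (φ + μ • weyl X φ) = ((1 + symp r X : ℝ) : ℂ) := by
      simp only [corr_add_left, corr_add_right, corr_smul_left, corr_smul_right, corr_weyl_weyl,
        h0, h0', h1]
      push_cast
      linear_combination (symp r X : ℂ) * hμ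
    rw [hscale, weylSq, h, corr_smul_left, this, norm_mul, hc, Complex.norm_real,
      Real.norm_eq_abs, one_mul, sq_abs]
    rcases symp_eq_or r X with h | h <;> rw [h] <;> norm_num
  have hLX (r) (hr : r ∈ lagr φ) :
      weylSq (neighbor φ X μ) (r + X) ^ 2 = (1 + symp r X * σ) / 2 := by
    obtain ⟨c, hc, h⟩ := hact r hr
    have : corr (weyl X (φ + (symp r X * μ) • weyl X φ)) (φ + μ • weyl X φ) =
        (starRingEnd ℂ) μ * ((1 + symp r X * σ : ℝ) : ℂ) := by
      rw [weyl_add, weyl_smul, weyl_weyl_self]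
      simp only [corr_add_left, corr_add_right, corr_smul_left, corr_smul_right, corr_weyl_weyl,
        h0, h0', h1]
      push_cast
      rw [← hσ2]
      linear_combination (-(symp r X : ℂ) * μ * sgn X.2 X.1) * hμ
    have hn : ‖(sgn r.2 X.1 : ℂ)‖ = 1 := by
      rcases sgn_eq_or r.2 X.1 with h | h <;> simp [h]
    rw [hscale, weylSq, add_comm r X, weyl_add_index, h, weyl_smul, corr_smul_left,
      corr_smul_left, this, norm_mul, norm_mul, norm_mul, hn, hc, RCLike.norm_conj, hμn,
      Complex.norm_real, Real.norm_eq_abs, one_mul, one_mul, one_mul, sq_abs]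
    rcases symp_eq_or r X with h | h <;> rcases hσ with h' | h' <;> rw [h, h'] <;> norm_num
  refine isStabilizer_of_le hnorm (le_trans (le_of_eq ?_)
    (sum_lagr_add_le hφ hX (fun p => weylSq (neighbor φ X μ) p ^ 2) fun p => by positivity))
  rw [Finset.sum_congr rfl fun r hr => by rw [hL r hr, hLX r hr]]
  -- Since `X ∉ lagr φ`, its character is balanced on `lagr φ`, so the terms in `σ` cancel.
  have hz : ∑ r ∈ lagr φ, symp r X = 0 := by
    rw [sum_lagr_symp_left hφ, weylSq, h0]; simp
  have : ∀ r ∈ lagr φ, (1 + symp r X) / 2 + (1 + symp r X * σ) / 2 = 1 + (1 + σ) / 2 * symp r X :=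
    fun r _ => by ring
  rw [Finset.sum_congr rfl this, Finset.sum_add_distrib, ← Finset.mul_sum, hz]
  simp [card_lagr hφ]

/-! ### The scalar inequality for local maximizers -/

/-- If the right side were small, `b` and `p` would be within `O(δ)` of `1`, where `δ = γ - 1 / 2`.
Then `1 + b + 2 * p > 4 - 2.25 * δ`, and multiplying by `1 / 2 + δ` exceeds `2`. -/
lemma local_max_inequality_normalized {γ b p q : ℝ} (h1 : 1 / 2 < γ) (h2 : γ < 1) (hp : 0 ≤ p)
    (hqp : q ^ 2 ≤ p ^ 2) (hb : p ^ 2 + q ^ 2 = b) (h : γ * (1 + b + 2 * p) ≤ 2) :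
    (γ - 1 / 2) ^ 2 ≤ 2 * ((1 - b ^ 2) ^ 2 + 16 * (p ^ 2 * q ^ 2)) := by
  obtain ⟨δ, rfl⟩ : ∃ δ, γ = 1 / 2 + δ := ⟨γ - 1 / 2, by ring⟩
  have hδ0 : 0 < δ := by linarith
  have hδ1 : δ < 1 / 2 := by linarith
  rw [add_sub_cancel_left]
  by_contra! hc
  have hpq : 0 ≤ p ^ 2 * q ^ 2 := by positivity
  have hb0 : 0 ≤ b := by rw [← hb]; positivity
  -- The negated goal gives `(1 - b ^ 2) ^ 2 < δ ^ 2 / 2`, and `0.71` exceeds `1 / √2`.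
  have hb1 : 1 - b ^ 2 < 0.71 * δ := by
    apply lt_of_pow_lt_pow_left₀ 2 (by positivity)
    nlinarith
  have hbl : 1 - 0.71 * δ < b := by
    by_contra! hb'
    nlinarith
  have hpb : b / 2 ≤ p ^ 2 := by linarith
  have hq : q ^ 2 ≤ δ / 20 := by
    by_contra! hq
    have : 0.3 * (δ / 20) ≤ p ^ 2 * q ^ 2 :=
      mul_le_mul (by nlinarith) hq.le (by positivity) (by positivity)
    nlinarith
  have hpl : 1 - 0.77 * δ < p := by
    by_contra! hp'
    nlinarith
  nlinarith

lemma local_max_inequality {γ A B x y : ℝ} (h1 : 1 / 2 < γ) (h2 : γ < 1) (hA : 0 < A)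
    (hxy : x ^ 2 + y ^ 2 = A * B) (hx : γ * (A + B + 2 * |x|) ≤ 2 * A)
    (hy : γ * (A + B + 2 * |y|) ≤ 2 * A) :
    (γ - 1 / 2) ^ 2 * A ^ 4 ≤ 2 * ((A ^ 2 - B ^ 2) ^ 2 + 16 * (x ^ 2 * y ^ 2)) := by
  have scale (t : ℝ) (ht : γ * (A + B + 2 * |t|) ≤ 2 * A) :
      γ * (1 + B / A + 2 * (|t| / A)) ≤ 2 := by
    rw [← div_le_iff₀ hA] at ht
    refine le_trans (le_of_eq ?_) ht
    field_simp
  have hsum : (|x| / A) ^ 2 + (|y| / A) ^ 2 = B / A := by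
    rw [div_pow, div_pow, sq_abs, sq_abs, ← add_div, hxy]; field_simp
  have main : (γ - 1 / 2) ^ 2 ≤
      2 * ((1 - (B / A) ^ 2) ^ 2 + 16 * ((|x| / A) ^ 2 * (|y| / A) ^ 2)) := by
    rcases le_total ((|y| / A) ^ 2) ((|x| / A) ^ 2) with h | h
    · exact local_max_inequality_normalized h1 h2 (by positivity) h hsum (scale x hx)
    · rw [mul_comm ((|x| / A) ^ 2)]
      exact local_max_inequality_normalized h1 h2 (by positivity) h ((add_comm _ _).trans hsum)
        (scale y hy)
  rw [div_pow |x|, div_pow |y|, sq_abs, sq_abs] at main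
  calc (γ - 1 / 2) ^ 2 * A ^ 4 ≤ _ := mul_le_mul_of_nonneg_right main (by positivity)
    _ = _ := by field_simp

/-! ### Mass bound for local maximizers -/

lemma IsApproxLocalMaximizer.mul_neighbor_le {γ : ℝ} {f φ : F2 n → ℂ}
    (hφ : IsApproxLocalMaximizer γ f φ) {X : F2 n × F2 n} (hX : X ∉ lagr φ) {μ : ℂ}
    (hμ : μ * (starRingEnd ℂ) μ = 1) (hμ2 : μ ^ 2 = 1 ∨ μ ^ 2 = -1) :
    γ * (‖corr f φ‖ ^ 2 + ‖corr f (weyl X φ)‖ ^ 2 +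
      2 * (μ * (corr f φ * (starRingEnd ℂ) (corr f (weyl X φ)))).re) ≤ 2 * ‖corr f φ‖ ^ 2 := by
  have h := hφ.2 _ (isStabilizer_neighbor hφ.1 hX hμ hμ2) (norm_corr_self_neighbor hφ.1 hX μ)
  rw [norm_corr_neighbor_sq, Complex.sq_norm (_ + _), Complex.normSq_add, Complex.normSq_mul,
    Complex.normSq_conj, map_mul, Complex.conj_conj, ← Complex.sq_norm, ← Complex.sq_norm,
    ← Complex.sq_norm] at h
  have hμn : ‖μ‖ ^ 2 = 1 := by
    rw [Complex.mul_conj'] at hμ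
    exact_mod_cast hμ
  rw [hμn, mul_left_comm (corr f φ)] at h
  linarith

lemma IsApproxLocalMaximizer.le_convMass {γ τ : ℝ} (h1 : 1 / 2 < γ) (h2 : γ < 1) (hτ : 0 < τ)
    {f φ : F2 n → ℂ} (hf : l2norm f ≤ 1) (hφ : IsApproxLocalMaximizer γ f φ)
    (hcorr : τ ≤ ‖corr f φ‖) {X : F2 n × F2 n} (hX : X ∉ lagr φ) :
    (γ - 1 / 2) ^ 2 * τ ^ 8 / 4 ≤ convMass f {p | p ∈ lagr φ ∧ symp X p = -1} := by
  set α := corr f φ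
  set β := corr f (weyl X φ)
  set w := α * (starRingEnd ℂ) β with hw
  have hA : 0 < ‖α‖ ^ 2 := pow_pos (hτ.trans_le hcorr) 2
  have hxy : w.re ^ 2 + w.im ^ 2 = ‖α‖ ^ 2 * ‖β‖ ^ 2 := by
    rw [sq, sq, ← Complex.normSq_apply, ← Complex.sq_norm, hw, norm_mul, RCLike.norm_conj, mul_pow]
  have hx : γ * (‖α‖ ^ 2 + ‖β‖ ^ 2 + 2 * |w.re|) ≤ 2 * ‖α‖ ^ 2 := by
    -- The phases `±1` control the real part of `w`, and `±i` below control its imaginary part.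
    rcases abs_choice w.re with h | h <;> rw [h]
    · have := hφ.mul_neighbor_le hX (μ := 1) (by simp) (by simp)
      rw [one_mul] at this
      exact this
    · have := hφ.mul_neighbor_le hX (μ := -1) (by simp) (by simp)
      rw [neg_one_mul, Complex.neg_re] at this
      exact this
  have hy : γ * (‖α‖ ^ 2 + ‖β‖ ^ 2 + 2 * |w.im|) ≤ 2 * ‖α‖ ^ 2 := by
    rcases abs_choice w.im with h | h <;> rw [h]
    · have := hφ.mul_neighbor_le hX (μ := -Complex.I) (by simp) (by simp)
      rw [neg_mul, Complex.neg_re, Complex.I_mul_re, neg_neg] at this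
      exact this
    · have := hφ.mul_neighbor_le hX (μ := Complex.I) (by simp) (by simp)
      rw [Complex.I_mul_re] at this
      exact this
  have key := local_max_inequality h1 h2 hA hxy hx hy
  have hsum := le_sum_weylSq hφ.1 hX f
  have hre : (w ^ 4).re = (‖α‖ ^ 2 * ‖β‖ ^ 2) ^ 2 - 8 * (w.re ^ 2 * w.im ^ 2) := by
    rw [← hxy]
    simp only [pow_succ, pow_zero, one_mul, Complex.mul_re, Complex.mul_im]
    ring
  rw [hre] at hsum
  have hf0 : 0 < l2norm f := by
    refine (l2norm_nonneg f).lt_of_ne' fun h => ?_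
    have := corr_le f φ
    rw [h] at this
    simp only [ne_eq, OfNat.ofNat_ne_zero, not_false_eq_true, zero_pow, zero_mul] at this
    exact absurd hA this.not_gt
  have hf8 : l2norm f ^ 8 ≤ 1 := pow_le_one₀ hf0.le hf
  rw [convMass_lagrangian_symp hφ.1]
  have hτ8 : τ ^ 8 ≤ (‖α‖ ^ 2) ^ 4 := by
    rw [← pow_mul]; exact pow_le_pow_left₀ hτ.le hcorr 8
  have hδ : (γ - 1 / 2) ^ 2 * τ ^ 8 ≤ (γ - 1 / 2) ^ 2 * (‖α‖ ^ 2) ^ 4 :=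
    mul_le_mul_of_nonneg_left hτ8 (sq_nonneg _)
  set D := (‖α‖ ^ 2) ^ 4 + (‖β‖ ^ 2) ^ 4 -
    2 * ((‖α‖ ^ 2 * ‖β‖ ^ 2) ^ 2 - 8 * (w.re ^ 2 * w.im ^ 2)) with hD
  have hDle : (γ - 1 / 2) ^ 2 * τ ^ 8 / 4 ≤ D / 2 := by
    have : D = ((‖α‖ ^ 2) ^ 2 - (‖β‖ ^ 2) ^ 2) ^ 2 + 16 * (w.re ^ 2 * w.im ^ 2) := by
      rw [hD]; ring
    linarith
  have hD0 : 0 ≤ D / 2 := le_trans (by positivity) hDle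
  calc _ ≤ D / 2 := hDle
    -- The normalization of P_f can only help, because `‖f‖₂ ≤ 1`.
    _ ≤ D / 2 / l2norm f ^ 8 := le_div_self hD0 (by positivity) hf8
    _ = (1 / (2 ^ n * l2norm f ^ 4)) ^ 2 * (2 ^ n / 2) * (2 ^ n * D) := by field_simp
    _ ≤ _ := mul_le_mul_of_nonneg_left hsum (by positivity)

end StabilizerState

end

/-! ### Conclusion -/

theorem lemma3p7 (n : ℕ) (γ τ ε : ℝ) (hγ : γ ∈ Set.Ioo (1 / 2 : ℝ) 1) (hτ : 0 < τ)
    (hε : ε = (γ - 1 / 2) ^ 2 * τ ^ 8 / 8)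
    (f φ : StabilizerState.F2 n → ℂ) (hf : StabilizerState.l2norm f ≤ 1)
    (hφ : StabilizerState.IsApproxLocalMaximizer γ f φ)
    (hcorr : τ ≤ ‖StabilizerState.corr f φ‖)
    (hrob : ¬ StabilizerState.RobustlyGenerates ε f (StabilizerState.lagrangian φ)) :
    ε ≤ StabilizerState.convMass f
      (StabilizerState.lagrangian φ \ StabilizerState.spec f) := by
  open StabilizerState in
  simp only [RobustlyGenerates, not_forall, Set.not_subset] at hrob
  obtain ⟨F, hF, z, hz, hzF⟩ := hrob
  obtain ⟨ℓ, hℓz, hℓF⟩ := Submodule.exists_le_ker_of_notMem hzF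
  obtain ⟨X, hX⟩ := exists_symp_eq ℓ
  have hXz : symp X z = -1 := by
    rcases symp_eq_or X z with h | h
    · rw [hX] at h
      have : ∀ t : ZMod 2, t ≠ 0 → t = 1 := by decide
      rw [this _ hℓz] at h
      norm_num [ZMod.val_one] at h
    · exact h
  have hXL : X ∉ lagr φ := fun h => by
    have := symp_eq_one_of_mem hφ.1 h (mem_lagrangian.1 hz)
    rw [hXz] at this
    norm_num at this
  -- This lower bound is exactly `2 * ε`; the spectral part takes at most `ε` of it.
  have hmass := hφ.le_convMass hγ.1 hγ.2 hτ hf hcorr hXL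
  rw [← convMass_inter_add_diff f _ (spec f)] at hmass
  have hspec : convMass f ({p | p ∈ lagr φ ∧ symp X p = -1} ∩ spec f) ≤ ε := by
    refine (convMass_mono f ?_).trans hF
    rintro p ⟨⟨-, hp⟩, hps⟩
    refine ⟨hps, fun hpF => ?_⟩
    have : ℓ p = 0 := hℓF (Submodule.subset_span hpF)
    rw [hX, this] at hp
    norm_num at hp
  have hdiff : convMass f ({p | p ∈ lagr φ ∧ symp X p = -1} \ spec f) ≤
      convMass f (lagrangian φ \ spec f) :=
    convMass_mono f fun p hp => ⟨mem_lagrangian.2 hp.1.1, hp.2⟩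
  linarith
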